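/- Let $\mathbb K$ be a field with $\operatorname{char}\mathbb K\neq 2$, let $V$ be a $\mathbb K$-vector space with basis $v_1,\dots,v_n$, and let $q_{ij}\in\mathbb K^*$ $(1\le i,j\le n)$ satisfy $q_{ij}q_{ji}=1$ for $i\neq j$. Let $$\Lambda=\Lambda_{\mathbf q}(V)=\mathbb K\langle v_1,\dots,v_n\mid v_jv_i=q_{ij}v_iv_j\ (i\neq j),\ v_i^2=0\rangle$$ be the quantum exterior algebra. Let $G$ be a finite group with $\operatorname{char}\mathbb K\nmid |G|$ that acts diagonally on $\Lambda$ by $\mathbb K$-algebra automorphisms, ${}^gv_i=g_i^i\,v_i$ with $g_i^i\in\mathbb K^*$, and let $\Lambda\rtimes G$ be the skew group algebra, with multiplication $(ag)(bh)=a({}^gb)gh$. Let $\mathrm{HH}^2(\Lambda,\Lambda\rtimes G)$ be the second Hochschild cohomology, computed from the bar resolution as Hochschild 2-cocycles $\mu:\Lambda\otimes\Lambda\to\Lambda\rtimes G$ modulo coboundaries. For $r\le s$ put $$\epsilon_{2[r]}=v_r\otimes v_r,\qquad \epsilon_{[r]+[s]}=v_r\otimes v_s-q_{sr}\,v_s\otimes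 v_r\quad(r<s).$$ Call a Hochschild 2-cocycle $\mu$ constant if $\mu(\epsilon_{[r]+[s]})\in\mathbb KG$ for all $r\le s$. For $g\in G$ and $i<j$, a class in $\mathrm{HH}^2(\Lambda,\Lambda\rtimes G)$ is said to be given by $g\,\epsilon^*_{[i]+[j]}$ if it is the class of a 2-cocycle $\mu$ with $\mu(\epsilon_{[i]+[j]})=g$ and $\mu(\epsilon_{[r]+[s]})=0$ for all other pairs $r\le s$. Then the subspace of $\mathrm{HH}^2(\Lambda,\Lambda\rtimes G)$ consisting of the classes of the constant 2-cocycles $\mu$ with $\mu(v_i\otimes v_i)=0$ for all $i$ is $$\bigoplus_{g\in G}\ \bigoplus_{(i,j)\in I_g}\operatorname{Span}_{\mathbb K}\{g\,\epsilon^*_{[i]+[j]}\},$$ where $I_g$ is the set of the pairs $i<j$ with $$-q_{ij}=g_i^i,\qquad -q_{ji}=g_j^j,\qquad q_{ki}q_{kj}=g_k^k\ \text{ for all } k\neq i,j .$$ More precisely, for each $g\in G$ and $(i,j)\in I_g$ exactly one class in $\mathrm{HH}^2(\Lambda,\Lambda\rtimes G)$ is given by $g\,\epsilon^*_{[i]+[j]}$,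 and these classes, for $g\in G$ and $(i,j)\in I_g$, form a basis of this subspace. -/

import Mathlib

open scoped TensorProduct

noncomputable section

/-! ### The quantum exterior algebra -/

/-- The defining relations `v_j v_i = q_{ij} v_i v_j` for `i ≠ j` and `v_i ^ 2 = 0`. -/
inductive QuantumExteriorRel {K : Type*} [Field K] {n : ℕ} (q : Fin n → Fin n → K) :
    FreeAlgebra K (Fin n) → FreeAlgebra K (Fin n) → Prop
  | comm (i j : Fin n) (hij : i ≠ j) :
      QuantumExteriorRel q (FreeAlgebra.ι K j * FreeAlgebra.ι K i)
        (q i j • (FreeAlgebra.ι K i * FreeAlgebra.ι K j))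
  | sq (i : Fin n) :
      QuantumExteriorRel q (FreeAlgebra.ι K i * FreeAlgebra.ι K i) 0

/-- The quantum exterior algebra `Λ_q(V)` of the vector space `V` with basis `v_1, …, v_n`. -/
def QuantumExterior {K : Type*} [Field K] {n : ℕ} (q : Fin n → Fin n → K) : Type _ :=
  RingQuot (QuantumExteriorRel q)

namespace QuantumExterior

instance instRing {K : Type*} [Field K] {n : ℕ} (q : Fin n → Fin n → K) :
    Ring (QuantumExterior q) :=
  RingQuot.instRing (QuantumExteriorRel q)

instance instAlgebra {K : Type*} [Field K] {n : ℕ} (q : Fin n → Fin n → K) :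
    Algebra K (QuantumExterior q) :=
  RingQuot.instAlgebra (QuantumExteriorRel q)

/-- The generator `v_i` of `Λ_q(V)`. -/
def gen {K : Type*} [Field K] {n : ℕ} (q : Fin n → Fin n → K) (i : Fin n) : QuantumExterior q :=
  RingQuot.mkAlgHom K (QuantumExteriorRel q) (FreeAlgebra.ι K i)

end QuantumExterior

/-! ### Second Hochschild cohomology

`B` is a `K`-algebra, regarded as an `A`-bimodule through an algebra homomorphism `φ : A → B`.
Hochschild `m`-cochains are the `A`-bimodule maps from the `m`-th term `A ⊗ A^{⊗ m} ⊗ A` of the bar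
resolution to `B`, that is, the `K`-linear maps `A^{⊗ m} → B`. -/

section Hochschild

variable {K : Type*} [Field K] {A : Type*} [Ring A] [Algebra K A] {B : Type*} [Ring B] [Algebra K B]

/-- The Hochschild 2-cocycles of `A` with values in `B`. -/
def hochschildZ2 (φ : A →ₐ[K] B) : Submodule K (A ⊗[K] A →ₗ[K] B) where
  carrier := {μ | ∀ a b c : A,
    φ a * μ (b ⊗ₜ c) - μ ((a * b) ⊗ₜ c) + μ (a ⊗ₜ (b * c)) - μ (a ⊗ₜ b) * φ c = 0}
  zero_mem' := by intro a b c; simp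
  add_mem' := by
    intro μ ν hμ hν a b c
    have h := congrArg₂ (· + ·) (hμ a b c) (hν a b c)
    simp only [add_zero] at h
    rw [← h]
    simp only [LinearMap.add_apply, mul_add, add_mul]
    abel
  smul_mem' := by
    intro r μ hμ a b c
    have h := congrArg (r • ·) (hμ a b c)
    simp only [smul_zero] at h
    rw [← h]
    simp only [LinearMap.smul_apply, mul_smul_comm, smul_mul_assoc, smul_sub, smul_add]

/-- The Hochschild 2-coboundaries of `A` with values in `B`. -/
def hochschildB2 (φ : A →ₐ[K] B) : Submodule K (A ⊗[K] A →ₗ[K] B) where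
  carrier := {μ | ∃ f : A →ₗ[K] B, ∀ a b : A,
    μ (a ⊗ₜ b) = φ a * f b - f (a * b) + f a * φ b}
  zero_mem' := ⟨0, by intro a b; simp⟩
  add_mem' := by
    rintro μ ν ⟨f, hf⟩ ⟨f', hf'⟩
    refine ⟨f + f', fun a b => ?_⟩
    simp only [LinearMap.add_apply, hf, hf', mul_add, add_mul]
    abel
  smul_mem' := by
    rintro r μ ⟨f, hf⟩
    refine ⟨r • f, fun a b => ?_⟩
    simp only [LinearMap.smul_apply, hf, mul_smul_comm, smul_mul_assoc, smul_sub, smul_add]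

/-- Coboundaries are cocycles. -/
theorem hochschildB2_le_hochschildZ2 (φ : A →ₐ[K] B) : hochschildB2 φ ≤ hochschildZ2 φ := by
  rintro μ ⟨f, hf⟩ a b c
  simp only [hf, map_mul, mul_add, mul_sub, add_mul, sub_mul, mul_assoc]
  abel

/-- The second Hochschild cohomology `HH²(A, B)`: cocycles modulo coboundaries, realized as the image
of the space of cocycles in the quotient of the space of all cochains by the coboundaries. -/
abbrev HochschildH2 (φ : A →ₐ[K] B) : Submodule K ((A ⊗[K] A →ₗ[K] B) ⧸ hochschildB2 φ) :=
  (hochschildZ2 φ).map (hochschildB2 φ).mkQ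

/-- The class in `HH²(A, B)` of a Hochschild 2-cocycle. -/
def hochschildClass (φ : A →ₐ[K] B) : hochschildZ2 φ →ₗ[K] HochschildH2 φ :=
  (hochschildB2 φ).mkQ.submoduleMap (hochschildZ2 φ)

end Hochschild

/-! ### Constant 2-cocycles with values in `Λ_q(V) ⋊ G` -/

namespace QuantumExterior

section Skew

variable {K : Type*} [Field K] {n : ℕ} (q : Fin n → Fin n → K) (G : Type*) [Group G]
  [MulSemiringAction G (QuantumExterior q)] [SMulCommClass G K (QuantumExterior q)]

/-- The skew group algebra `Λ_q(V) ⋊ G`, with `(a g)(b h) = a (ᵍb) g h`. -/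
abbrev Skew : Type _ := SkewMonoidAlgebra (QuantumExterior q) G

/-- The inclusion `Λ_q(V) → Λ_q(V) ⋊ G`, `a ↦ a 1`. -/
def incl : QuantumExterior q →ₐ[K] Skew q G :=
  { (SkewMonoidAlgebra.singleOneRingHom : QuantumExterior q →+* Skew q G) with
    commutes' := fun _ => rfl }

variable {G} in
/-- The element `g` of `Λ_q(V) ⋊ G`. -/
def grp (g : G) : Skew q G := SkewMonoidAlgebra.single g 1

/-- The subspace `K G` of `Λ_q(V) ⋊ G`. -/
def groupPart : Submodule K (Skew q G) := Submodule.span K (Set.range (grp q (G := G)))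

/-- The middle part of the element `ε_{[r]+[s]}`, `r ≤ s`, of the bar resolution:
`ε_{2[r]} = 1 ⊗ v_r ⊗ v_r ⊗ 1` and
`ε_{[r]+[s]} = 1 ⊗ v_r ⊗ v_s ⊗ 1 - q_{sr} ⊗ v_s ⊗ v_r ⊗ 1` for `r < s`. -/
def eps (r s : Fin n) : QuantumExterior q ⊗[K] QuantumExterior q :=
  if r = s then gen q r ⊗ₜ gen q r
  else gen q r ⊗ₜ gen q s - q s r • (gen q s ⊗ₜ gen q r)

/-- The index set of the free bimodule generators `ε_{[r]+[s]}`, `r ≤ s`, of the degree 2 term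
`C₂` of the small resolution of `Λ_q(V)` inside the bar resolution. -/
abbrev Deg2 (n : ℕ) : Type := {p : Fin n × Fin n // p.1 ≤ p.2}

/-- `Hom_{Λᵉ}(C₂, Λ_q(V) ⋊ G)`: a bimodule map is given by its values on the `ε_{[r]+[s]}`. -/
abbrev SmallCochain2 : Type _ := Deg2 n → Skew q G

/-- Restriction of a Hochschild 2-cochain from the bar resolution to `C₂`. -/
def restrict (μ : QuantumExterior q ⊗[K] QuantumExterior q →ₗ[K] Skew q G) :
    SmallCochain2 q G :=
  fun p => μ (eps q p.1.1 p.1.2)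

variable {G} in
/-- The cochain `g ε_{[i]+[j]}^*` for `i < j`: it sends `ε_{[i]+[j]}` to `g` and the other
generators of `C₂` to `0`. -/
def grpEpsStar (g : G) (i j : Fin n) (hij : i < j) : SmallCochain2 q G :=
  Pi.single (⟨(i, j), hij.le⟩ : Deg2 n) (grp q g)

/-- A class in `HH²(Λ_q(V), Λ_q(V) ⋊ G)` is given by the cochain `η` on `C₂` if it is the class of
a Hochschild 2-cocycle that restricts to `η`. -/
def IsClassOf (c : HochschildH2 (incl q G)) (η : SmallCochain2 q G) : Prop :=
  ∃ μ : hochschildZ2 (incl q G), hochschildClass (incl q G) μ = c ∧ restrict q G μ.1 = η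

/-- The constant Hochschild 2-cocycles (all `ε_{[r]+[s]}` are sent into `K G`) that send every
`v_i ⊗ v_i` to `0`. -/
def constCocycles : Submodule K (hochschildZ2 (incl q G)) where
  carrier := {μ | (∀ p : Deg2 n, restrict q G μ.1 p ∈ groupPart q G) ∧
    ∀ i : Fin n, μ.1 (gen q i ⊗ₜ gen q i) = 0}
  zero_mem' := ⟨fun _ => Submodule.zero_mem _, fun _ => rfl⟩
  add_mem' := by
    rintro μ ν ⟨hμ, hμ'⟩ ⟨hν, hν'⟩
    refine ⟨fun p => Submodule.add_mem _ (hμ p) (hν p), fun i => ?_⟩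
    have h : (μ + ν).1 (gen q i ⊗ₜ gen q i)
        = μ.1 (gen q i ⊗ₜ gen q i) + ν.1 (gen q i ⊗ₜ gen q i) := rfl
    rw [h, hμ', hν', add_zero]
  smul_mem' := by
    rintro r μ ⟨hμ, hμ'⟩
    refine ⟨fun p => Submodule.smul_mem _ r (hμ p), fun i => ?_⟩
    have h : (r • μ).1 (gen q i ⊗ₜ gen q i) = r • μ.1 (gen q i ⊗ₜ gen q i) := rfl
    rw [h, hμ', smul_zero]

/-- The subspace of `HH²(Λ_q(V), Λ_q(V) ⋊ G)` of the classes of constant 2-cocycles that send every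
`v_i ⊗ v_i` to `0`. -/
def constClasses : Submodule K (HochschildH2 (incl q G)) :=
  (constCocycles q G).map (hochschildClass (incl q G))

end Skew

/-- The triples `(g, i, j)` with `i < j` such that `g_i^i = -q_{ij}`, `g_j^j = -q_{ji}` and
`g_k^k = q_{ki} q_{kj}` for all `k ≠ i, j`. Here `d g i` stands for the scalar `g_i^i`. -/
structure DiagIndex {K : Type*} [Field K] {n : ℕ} (q : Fin n → Fin n → K) {G : Type*}
    (d : G → Fin n → K) where
  g : G
  i : Fin n
  j : Fin n
  lt : i < j
  eig_left : -q i j = d g i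
  eig_right : -q j i = d g j
  eig_other : ∀ k : Fin n, k ≠ i → k ≠ j → q k i * q k j = d g k

end QuantumExterior

end

/-! ### The universal property of the quantum exterior algebra -/

namespace QuantumExterior

variable {K : Type*} [Field K] {n : ℕ} {q : Fin n → Fin n → K}

/-! A 2-cocycle `μ` is the same as an associative product on `Λ ⊕ (Λ ⋊ G)`, the square-zero
extension `HochschildExt μ`; it is a coboundary as soon as the extension splits. By the universal
property of `Λ`, lifts of the generators that still satisfy the defining relations give a splitting,
and the lifts `(v_i, 0)` fail these relations by exactly the values of `μ` on the `ε_{[r]+[s]}`.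
Hence these values determine the class (`mem_hochschildB2_of_restrict_eq_zero`).

The conditions on `g_k^k` are necessary by associativity in the extension. If the value on
`ε_{[r]+[s]}` has a nonzero constant term at `g`, then the overlaps `v_r v_r v_s`, `v_r v_s v_s` and
`v_k v_r v_s`, read off at `v_r g`, `v_s g` and `v_k g`, give the three families of equations
(`eig_left_of_cochainCoeff_ne_zero` and its two companions).

They are sufficient because `g ε_{[i]+[j]}^*` is realized by the cup product of the skew derivations
dual to `v_i` and `v_j`; it is a cocycle when their twists compose to the action of `g`
(`cupCochain_mem`).

Independence holds because the constant terms on `ε_{[r]+[s]}`, `r < s`, vanish on coboundaries.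
Only the quotient of `Λ` by degree at least two is used to detect coefficients; a monomial basis is
never needed. -/

theorem gen_mul_gen (i j : Fin n) (hij : i ≠ j) :
    gen q j * gen q i = q i j • (gen q i * gen q j) := by
  have h := RingQuot.mkAlgHom_rel K (QuantumExteriorRel.comm (q := q) i j hij)
  rw [map_mul, map_smul, map_mul] at h
  exact h

theorem gen_mul_self (i : Fin n) : gen q i * gen q i = 0 := by
  have h := RingQuot.mkAlgHom_rel K (QuantumExteriorRel.sq (q := q) i)
  rw [map_mul, map_zero] at h
  exact h

/-- Elements of an algebra that satisfy the defining relations define an algebra homomorphism. -/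
noncomputable def lift {E : Type*} [Ring E] [Algebra K E] (f : Fin n → E)
    (hcomm : ∀ i j, i ≠ j → f j * f i = q i j • (f i * f j)) (hsq : ∀ i, f i * f i = 0) :
    QuantumExterior q →ₐ[K] E :=
  RingQuot.liftAlgHom K ⟨FreeAlgebra.lift K f, by
    intro x y h
    cases h with
    | comm i j hij => simpa using hcomm i j hij
    | sq i => simpa using hsq i⟩

@[simp]
theorem lift_gen {E : Type*} [Ring E] [Algebra K E] (f : Fin n → E)
    (hcomm : ∀ i j, i ≠ j → f j * f i = q i j • (f i * f j)) (hsq : ∀ i, f i * f i = 0)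
    (i : Fin n) : lift f hcomm hsq (gen q i) = f i := by
  have h := RingQuot.liftAlgHom_mkAlgHom_apply K (s := QuantumExteriorRel q) (FreeAlgebra.lift K f)
    (by
      intro x y h
      cases h with
      | comm i j hij => simpa using hcomm i j hij
      | sq i => simpa using hsq i) (FreeAlgebra.ι K i)
  rw [FreeAlgebra.lift_ι_apply] at h
  exact h

theorem algHom_ext {E : Type*} [Ring E] [Algebra K E] {f g : QuantumExterior q →ₐ[K] E}
    (h : ∀ i, f (gen q i) = g (gen q i)) : f = g := by
  refine RingQuot.ringQuot_ext' K f g ?_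
  ext i
  exact h i

@[elab_as_elim]
theorem induction {C : QuantumExterior q → Prop} (algebraMap : ∀ r, C (algebraMap K _ r))
    (gen : ∀ i, C (gen q i)) (mul : ∀ a b, C a → C b → C (a * b))
    (add : ∀ a b, C a → C b → C (a + b)) (a : QuantumExterior q) : C a := by
  obtain ⟨x, rfl⟩ := RingQuot.mkAlgHom_surjective K (QuantumExteriorRel q) a
  induction x using FreeAlgebra.induction with
  | grade0 r =>
    rw [AlgHom.commutes]
    exact algebraMap r
  | grade1 i => exact gen i
  | mul a b ha hb =>
    rw [map_mul]
    exact mul _ _ ha hb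
  | add a b ha hb =>
    rw [map_add]
    exact add _ _ ha hb

attribute [local irreducible] instRing

/-! ### Skew derivations -/

section SkewDerivation

/-- A diagonal algebra endomorphism, `v_k ↦ c_k v_k`. -/
noncomputable def diag (q : Fin n → Fin n → K) (c : Fin n → K) :
    QuantumExterior q →ₐ[K] QuantumExterior q :=
  lift (fun k => c k • gen q k)
    (fun i j hij => by
      simp only [smul_mul_assoc, mul_smul_comm, gen_mul_gen i j hij, smul_smul]
      congr 1
      ring)
    (fun i => by simp [gen_mul_self])

@[simp]
theorem diag_gen (c : Fin n → K) (k : Fin n) : diag q c (gen q k) = c k • gen q k :=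
  lift_gen ..

/-- The scalars `c_k` for which there is a skew derivation along `v_k ↦ c_k v_k` dual to `v_i`. -/
def twist (q : Fin n → Fin n → K) (i k : Fin n) : K := if k = i then -1 else q k i

/-- The matrix algebra homomorphism that encodes the skew derivation dual to `v_i`. -/
noncomputable def skewDerivationMatrix (hq : ∀ i j, i ≠ j → q i j * q j i = 1) (i : Fin n) :
    QuantumExterior q →ₐ[K] Matrix (Fin 2) (Fin 2) (QuantumExterior q) :=
  -- A map `a ↦ [[a, D a], [0, σ a]]` is multiplicative exactly when `σ` is and `D (a b) = a D b + D
  -- a σ b`. The relation `v_i² = 0` forces `σ v_i = -v_i`, and the commutation of `v_k` with `v_i`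
  -- forces `σ v_k = q_{ki} v_k`.
  lift (fun k => !![gen q k, if k = i then 1 else 0; 0, twist q i k • gen q k])
    (fun a b hab => by
      have hab' := hq a b hab
      ext r s
      fin_cases r <;> fin_cases s
      · by_cases ha : a = i
        · subst ha
          simp [Matrix.mul_apply, gen_mul_gen a b hab]
        · simp [Matrix.mul_apply, gen_mul_gen a b hab, ha]
      · by_cases ha : a = i
        · subst ha
          have hb : b ≠ a := hab.symm
          simp [Matrix.mul_apply, twist, hb, smul_smul, hab']
        · by_cases hb : b = i
          · subst hb
            simp [Matrix.mul_apply, twist, ha]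
          · simp [Matrix.mul_apply, ha, hb]
      · simp [Matrix.mul_apply]
      · simp [Matrix.mul_apply, gen_mul_gen a b hab, smul_smul]
        congr 1
        ring)
    (fun a => by
      ext r s
      fin_cases r <;> fin_cases s
      · simp [Matrix.mul_apply, gen_mul_self]
      · by_cases ha : a = i
        · simp [Matrix.mul_apply, twist, ha]
        · simp [Matrix.mul_apply, ha]
      · simp [Matrix.mul_apply]
      · simp [Matrix.mul_apply, gen_mul_self])

theorem skewDerivationMatrix_apply (hq : ∀ i j, i ≠ j → q i j * q j i = 1) (i : Fin n)
    (a : QuantumExterior q) :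
    skewDerivationMatrix hq i a 0 0 = a ∧ skewDerivationMatrix hq i a 1 0 = 0 ∧
      skewDerivationMatrix hq i a 1 1 = diag q (twist q i) a := by
  induction a using QuantumExterior.induction with
  | algebraMap r => simp [Matrix.algebraMap_matrix_apply]
  | gen k => simp [skewDerivationMatrix]
  | mul a b ha hb =>
    obtain ⟨h1, h2, h3⟩ := ha
    obtain ⟨h4, h5, h6⟩ := hb
    simp [Matrix.mul_apply, h1, h2, h3, h4, h5, h6]
  | add a b ha hb =>
    obtain ⟨h1, h2, h3⟩ := ha
    obtain ⟨h4, h5, h6⟩ := hb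
    simp [h1, h2, h3, h4, h5, h6]

/-- The skew derivation of `Λ_q(V)` dual to `v_i`. -/
noncomputable def skewDerivation (hq : ∀ i j, i ≠ j → q i j * q j i = 1) (i : Fin n) :
    QuantumExterior q →ₗ[K] QuantumExterior q :=
  Matrix.entryLinearMap K (QuantumExterior q) 0 1 ∘ₗ (skewDerivationMatrix hq i).toLinearMap

theorem skewDerivation_gen (hq : ∀ i j, i ≠ j → q i j * q j i = 1) (i k : Fin n) :
    skewDerivation hq i (gen q k) = if k = i then 1 else 0 := by
  simp [skewDerivation, skewDerivationMatrix]

theorem skewDerivation_mul (hq : ∀ i j, i ≠ j → q i j * q j i = 1) (i : Fin n)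
    (a b : QuantumExterior q) :
    skewDerivation hq i (a * b) =
      a * skewDerivation hq i b + skewDerivation hq i a * diag q (twist q i) b := by
  have ha := skewDerivationMatrix_apply hq i a
  have hb := skewDerivationMatrix_apply hq i b
  simp [skewDerivation, Matrix.mul_apply, ha.1, hb.2.2]

end SkewDerivation

/-! ### The terms of degree at most one -/

/-- The quotient of `Λ_q(V)` by the terms of degree at least two. -/
noncomputable def lowDegree (q : Fin n → Fin n → K) :
    QuantumExterior q →ₐ[K] TrivSqZeroExt K (Fin n → K) :=
  lift (fun k => TrivSqZeroExt.inr (Pi.single k 1)) (fun i j _ => by simp) (fun i => by simp)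

@[simp]
theorem lowDegree_gen (k : Fin n) :
    lowDegree q (gen q k) = TrivSqZeroExt.inr (Pi.single k 1) :=
  lift_gen ..

end QuantumExterior

/-! ### Square-zero extensions by 2-cocycles -/

/-- The square-zero extension of `A` by `B` with the 2-cocycle `μ`. -/
structure HochschildExt {K : Type*} [Field K] {A : Type*} [Ring A] [Algebra K A] {B : Type*} [Ring B]
    [Algebra K B] {φ : A →ₐ[K] B} (μ : hochschildZ2 φ) where
  base : A
  fiber : B

namespace HochschildExt

variable {K : Type*} [Field K] {A : Type*} [Ring A] [Algebra K A] {B : Type*} [Ring B]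
  [Algebra K B] {φ : A →ₐ[K] B} {μ : hochschildZ2 φ}

@[ext]
theorem ext {x y : HochschildExt μ} (h : x.base = y.base) (h' : x.fiber = y.fiber) : x = y := by
  cases x
  cases y
  cases h
  cases h'
  rfl

/-- The underlying pair. -/
def equivProd (μ : hochschildZ2 φ) : HochschildExt μ ≃ A × B where
  toFun x := (x.base, x.fiber)
  invFun x := ⟨x.1, x.2⟩

noncomputable instance : AddCommGroup (HochschildExt μ) := (equivProd μ).addCommGroup
noncomputable instance : Module K (HochschildExt μ) := (equivProd μ).module K

@[simp] theorem base_zero : (0 : HochschildExt μ).base = 0 := rfl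
@[simp] theorem fiber_zero : (0 : HochschildExt μ).fiber = 0 := rfl
@[simp] theorem base_add (x y : HochschildExt μ) : (x + y).base = x.base + y.base := rfl
@[simp] theorem fiber_add (x y : HochschildExt μ) : (x + y).fiber = x.fiber + y.fiber := rfl
@[simp] theorem base_smul (r : K) (x : HochschildExt μ) : (r • x).base = r • x.base := rfl
@[simp] theorem fiber_smul (r : K) (x : HochschildExt μ) : (r • x).fiber = r • x.fiber := rfl

instance : Mul (HochschildExt μ) :=
  ⟨fun x y => ⟨x.base * y.base, φ x.base * y.fiber + x.fiber * φ y.base + μ.1 (x.base ⊗ₜ y.base)⟩⟩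

/-- Cocycles are not assumed normalized: `μ (1 ⊗ a) = μ (1 ⊗ 1) φ a`, so the unit needs the
correction `-μ (1 ⊗ 1)`. -/
instance : One (HochschildExt μ) := ⟨⟨1, -μ.1 (1 ⊗ₜ 1)⟩⟩

@[simp] theorem base_mul (x y : HochschildExt μ) : (x * y).base = x.base * y.base := rfl
@[simp] theorem fiber_mul (x y : HochschildExt μ) : (x * y).fiber =
    φ x.base * y.fiber + x.fiber * φ y.base + μ.1 (x.base ⊗ₜ y.base) := rfl
@[simp] theorem base_one : (1 : HochschildExt μ).base = 1 := rfl
@[simp] theorem fiber_one : (1 : HochschildExt μ).fiber = -μ.1 (1 ⊗ₜ 1) := rfl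

noncomputable instance : Ring (HochschildExt μ) :=
  { (inferInstance : AddCommGroup (HochschildExt μ)) with
    mul := (· * ·)
    one := 1
    zero_mul := fun x => by ext <;> simp
    mul_zero := fun x => by ext <;> simp
    left_distrib := fun x y z => by
      ext
      · simp [mul_add]
      · simp only [fiber_mul, base_add, fiber_add, mul_add, map_add, TensorProduct.tmul_add]
        abel
    right_distrib := fun x y z => by
      ext
      · simp [add_mul]
      · simp only [fiber_mul, base_add, fiber_add, add_mul, map_add, TensorProduct.add_tmul]
        abel
    mul_assoc := fun x y z => by
      ext
      · simp [mul_assoc]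
      · have h := μ.2 x.base y.base z.base
        rw [← sub_eq_zero, ← neg_eq_zero, ← h]
        simp only [fiber_mul, base_mul, map_mul, mul_add, add_mul, mul_assoc]
        abel
    one_mul := fun x => by
      ext
      · simp
      · have h := μ.2 1 1 x.base
        simp only [map_one, one_mul, sub_self, zero_add] at h
        simp only [fiber_mul, base_one, fiber_one, map_one, one_mul]
        rw [sub_eq_zero.1 h]
        simp
    mul_one := fun x => by
      ext
      · simp
      · have h := μ.2 x.base 1 1
        simp only [map_one, mul_one, sub_add_cancel] at h
        simp only [fiber_mul, base_one, fiber_one, map_one, mul_one]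
        rw [← sub_eq_zero.1 h]
        simp }

noncomputable instance : Algebra K (HochschildExt μ) :=
  Algebra.ofModule
    (fun r x y => by ext <;> simp [← TensorProduct.smul_tmul', smul_add])
    (fun r x y => by ext <;> simp [smul_add])

/-- The projection of the extension onto the base. -/
noncomputable def baseHom (μ : hochschildZ2 φ) : HochschildExt μ →ₐ[K] A :=
  AlgHom.ofLinearMap { toFun := base, map_add' := base_add, map_smul' := base_smul } rfl base_mul

/-- The projection of the extension onto the fiber. -/
noncomputable def fiberMap (μ : hochschildZ2 φ) : HochschildExt μ →ₗ[K] B :=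
  { toFun := fiber, map_add' := fiber_add, map_smul' := fiber_smul }

/-- A cocycle is a coboundary if its square-zero extension splits. -/
theorem mem_hochschildB2_of_section (s : A →ₐ[K] HochschildExt μ) (hs : ∀ a, (s a).base = a) :
    μ.1 ∈ hochschildB2 φ := by
  -- Multiplicativity of `s` says that its fiber `f` satisfies `f (a b) = φ a f b + f a φ b + μ (a ⊗
  -- b)`, so `μ` is the coboundary of `-f`.
  refine ⟨-(fiberMap μ ∘ₗ s.toLinearMap), fun a b => ?_⟩
  have h : (s (a * b)).fiber = _ := (congrArg fiber (map_mul s a b)).trans (fiber_mul _ _)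
  simp only [hs] at h
  change _ = φ a * -(s b).fiber - -(s (a * b)).fiber + -(s a).fiber * φ b
  rw [h]
  noncomm_ring

/-- The inclusion of the fiber. -/
def inr (μ : hochschildZ2 φ) (b : B) : HochschildExt μ := ⟨0, b⟩

/-- The linear section of the extension. -/
def inl (μ : hochschildZ2 φ) (a : A) : HochschildExt μ := ⟨a, 0⟩

@[simp] theorem base_inl (a : A) : (inl μ a).base = a := rfl
@[simp] theorem fiber_inl (a : A) : (inl μ a).fiber = 0 := rfl
@[simp] theorem base_inr (b : B) : (inr μ b).base = 0 := rfl
@[simp] theorem fiber_inr (b : B) : (inr μ b).fiber = b := rfl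

end HochschildExt

namespace QuantumExterior

attribute [local irreducible] instRing

variable {K : Type*} [Field K] {n : ℕ} {q : Fin n → Fin n → K} {G : Type*} [Group G]
  [MulSemiringAction G (QuantumExterior q)] [SMulCommClass G K (QuantumExterior q)]

/-! ### Coefficients in the skew group algebra -/

theorem coeff_incl_mul (a : QuantumExterior q) (x : Skew q G) (g : G) :
    (incl q G a * x).coeff g = a * x.coeff g :=
  SkewMonoidAlgebra.coeff_single_one_mul x a g

/-- Moving `a` to the left past `g` twists it by the action; this is how the eigenvalues `d g k`
enter the constraints. -/
theorem coeff_mul_incl (a : QuantumExterior q) (x : Skew q G) (g : G) :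
    (x * incl q G a).coeff g = x.coeff g * g • a :=
  SkewMonoidAlgebra.coeff_mul_single_one x a g

omit [Group G] [MulSemiringAction G (QuantumExterior q)] [SMulCommClass G K (QuantumExterior q)] in
theorem coeff_grp [DecidableEq G] (g h : G) :
    (grp q g).coeff h = if g = h then (1 : QuantumExterior q) else 0 :=
  SkewMonoidAlgebra.coeff_single_apply

/-- The coefficient at `g` of an element of `Λ_q(V) ⋊ G`. -/
noncomputable def coeffMap (q : Fin n → Fin n → K) {G : Type*} [Group G]
    [MulSemiringAction G (QuantumExterior q)] [SMulCommClass G K (QuantumExterior q)] (g : G) :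
    Skew q G →ₗ[K] QuantumExterior q where
  toFun x := x.coeff g
  map_add' x y := by simp
  map_smul' r x := by simp

/-- The constant term of the coefficient at `g`. -/
noncomputable def constCoeff (q : Fin n → Fin n → K) {G : Type*} [Group G]
    [MulSemiringAction G (QuantumExterior q)] [SMulCommClass G K (QuantumExterior q)] (g : G) :
    Skew q G →ₗ[K] K :=
  (TrivSqZeroExt.fstHom K K (Fin n → K)).toLinearMap ∘ₗ (lowDegree q).toLinearMap ∘ₗ coeffMap q g

/-- The coefficient at `v_k g`. -/
noncomputable def genCoeff (q : Fin n → Fin n → K) {G : Type*} [Group G]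
    [MulSemiringAction G (QuantumExterior q)] [SMulCommClass G K (QuantumExterior q)] (g : G)
    (k : Fin n) : Skew q G →ₗ[K] K :=
  LinearMap.proj k ∘ₗ TrivSqZeroExt.sndHom K (Fin n → K) ∘ₗ (lowDegree q).toLinearMap ∘ₗ
    coeffMap q g

theorem constCoeff_apply (g : G) (x : Skew q G) :
    constCoeff q g x = (lowDegree q (x.coeff g)).fst := rfl

theorem genCoeff_apply (g : G) (k : Fin n) (x : Skew q G) :
    genCoeff q g k x = (lowDegree q (x.coeff g)).snd k := rfl

theorem constCoeff_grp [DecidableEq G] (g h : G) :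
    constCoeff q h (grp q g) = if g = h then 1 else 0 := by
  rw [constCoeff_apply, coeff_grp]
  split_ifs <;> simp

theorem constCoeff_gen_mul (g : G) (k : Fin n) (x : Skew q G) :
    constCoeff q g (incl q G (gen q k) * x) = 0 := by
  simp [constCoeff_apply, coeff_incl_mul]

variable {d : G → Fin n → K}

theorem constCoeff_mul_gen (hd : ∀ (g : G) (i : Fin n), g • gen q i = d g i • gen q i)
    (g : G) (k : Fin n) (x : Skew q G) :
    constCoeff q g (x * incl q G (gen q k)) = 0 := by
  simp [constCoeff_apply, coeff_mul_incl, hd]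

/-- Modulo degree two, `v_k` times a coefficient sees only the constant term of that coefficient. -/
theorem genCoeff_gen_mul (g : G) (k l : Fin n) (x : Skew q G) :
    genCoeff q g l (incl q G (gen q k) * x) = if l = k then constCoeff q g x else 0 := by
  simp [genCoeff_apply, constCoeff_apply, coeff_incl_mul, Pi.single_apply]

theorem genCoeff_mul_gen (hd : ∀ (g : G) (i : Fin n), g • gen q i = d g i • gen q i)
    (g : G) (k l : Fin n) (x : Skew q G) :
    genCoeff q g l (x * incl q G (gen q k)) = if l = k then d g k * constCoeff q g x else 0 := by
  simp [genCoeff_apply, constCoeff_apply, coeff_mul_incl, hd, Pi.single_apply]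

/-- On `K G` every coefficient is a scalar, so passing to constant terms loses nothing. -/
theorem eq_zero_of_mem_groupPart {x : Skew q G} (hx : x ∈ groupPart q G)
    (h : ∀ g, constCoeff q g x = 0) : x = 0 := by
  classical
  have key : ∀ g, x.coeff g = algebraMap K _ (constCoeff q g x) := by
    clear h
    intro g
    induction hx using Submodule.span_induction with
    | mem y hy =>
      obtain ⟨g', rfl⟩ := hy
      rw [constCoeff_grp, coeff_grp]
      split_ifs <;> simp
    | zero => simp
    | add y z _ _ hy hz => simp [hy, hz]
    | smul r y _ hy =>
      rw [SkewMonoidAlgebra.coeff_smul, Finsupp.smul_apply, hy, map_smul, smul_eq_mul, map_mul,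
        Algebra.smul_def]
  ext g
  simp [key, h]

/-! ### Cochains restricted to the generators -/

/-- The constant term at `g` of the value of a 2-cochain on `ε_{[r]+[s]}`. -/
noncomputable def cochainCoeff (q : Fin n → Fin n → K) {G : Type*} [Group G]
    [MulSemiringAction G (QuantumExterior q)] [SMulCommClass G K (QuantumExterior q)] (g : G)
    (r s : Fin n) : (QuantumExterior q ⊗[K] QuantumExterior q →ₗ[K] Skew q G) →ₗ[K] K :=
  constCoeff q g ∘ₗ LinearMap.applyₗ (eps q r s)

theorem cochainCoeff_apply (g : G) (r s : Fin n)
    (μ : QuantumExterior q ⊗[K] QuantumExterior q →ₗ[K] Skew q G) :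
    cochainCoeff q g r s μ = constCoeff q g (μ (eps q r s)) := rfl

theorem eps_of_ne {r s : Fin n} (h : r ≠ s) :
    eps q r s = gen q r ⊗ₜ gen q s - q s r • (gen q s ⊗ₜ gen q r) := if_neg h

theorem eps_self (r : Fin n) : eps q r r = gen q r ⊗ₜ gen q r := if_pos rfl

/-- In the coboundary of `f`, the terms `f (v_r v_s)` and `q_{sr} f (v_s v_r)` cancel; every other
term has a generator as a factor, hence no constant term. -/
theorem cochainCoeff_of_mem_hochschildB2
    (hd : ∀ (g : G) (i : Fin n), g • gen q i = d g i • gen q i) (g : G) {r s : Fin n} (h : r ≠ s)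
    {μ : QuantumExterior q ⊗[K] QuantumExterior q →ₗ[K] Skew q G}
    (hμ : μ ∈ hochschildB2 (incl q G)) : cochainCoeff q g r s μ = 0 := by
  obtain ⟨f, hf⟩ := hμ
  rw [cochainCoeff_apply, eps_of_ne h, map_sub, map_smul, hf, hf, gen_mul_gen s r h.symm, map_smul]
  simp [constCoeff_gen_mul, constCoeff_mul_gen hd]

theorem eps_swap (hq : ∀ i j, i ≠ j → q i j * q j i = 1) {r s : Fin n} (h : r ≠ s) :
    eps q s r = -q r s • eps q r s := by
  rw [eps_of_ne h, eps_of_ne h.symm, smul_sub, smul_smul, neg_mul, hq r s h, neg_smul, neg_smul,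
    one_smul]
  abel

/-- A cocycle that vanishes on all `ε_{[r]+[s]}` is a coboundary. -/
theorem mem_hochschildB2_of_restrict_eq_zero (hq : ∀ i j, i ≠ j → q i j * q j i = 1)
    (μ : hochschildZ2 (incl q G)) (h : restrict q G μ.1 = 0) : μ.1 ∈ hochschildB2 (incl q G) := by
  have hle : ∀ r s, r ≤ s → μ.1 (eps q r s) = 0 := fun r s hrs => congrFun h ⟨(r, s), hrs⟩
  have heps : ∀ r s, μ.1 (eps q r s) = 0 := by
    intro r s
    rcases le_or_gt r s with hrs | hrs
    · exact hle r s hrs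
    · rw [eps_swap hq hrs.ne, map_smul, hle s r hrs.le, smul_zero]
  -- The lifts `(v_i, 0)` satisfy the defining relations because `μ` kills every `ε_{[r]+[s]}`, in
  -- either order of `r` and `s`.
  let σ : QuantumExterior q →ₐ[K] HochschildExt μ :=
    lift (fun i => HochschildExt.inl μ (gen q i))
      (fun i j hij => by
        ext : 1
        · simp [gen_mul_gen i j hij]
        · have := heps j i
          rw [eps_of_ne hij.symm, map_sub, map_smul] at this
          simpa using sub_eq_zero.1 this)
      (fun i => by
        ext : 1
        · simp [gen_mul_self]
        · have := heps i i
          rw [eps_self] at this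
          simpa using this)
  refine HochschildExt.mem_hochschildB2_of_section σ fun a => ?_
  have hσ : (HochschildExt.baseHom μ).comp σ = AlgHom.id K _ :=
    algHom_ext fun i => by
      simp only [AlgHom.comp_apply, σ, lift_gen]
      rfl
  exact DFunLike.congr_fun hσ a

/-! ### Constraints on constant cocycles -/

/-- Associativity of `x * x * y` when `x * y = p • (y * x) + h` and `x * x = 0`. -/
theorem mul_add_mul_eq_zero_of_sq_left {E : Type*} [Ring E] [Algebra K E] {x y h : E} {p : K}
    (hx : x * x = 0) (hxy : x * y = p • (y * x) + h) : x * h + p • (h * x) = 0 := by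
  have h1 : x * (x * y) = 0 := by rw [← mul_assoc, hx, zero_mul]
  have h2 : x * y * x = h * x := by rw [hxy, add_mul, smul_mul_assoc, mul_assoc, hx]; simp
  rw [hxy, mul_add, mul_smul_comm, ← mul_assoc, h2] at h1
  rw [← h1, add_comm]

/-- Associativity of `x * y * y` when `x * y = p • (y * x) + h` and `y * y = 0`. -/
theorem mul_add_mul_eq_zero_of_sq_right {E : Type*} [Ring E] [Algebra K E] {x y h : E} {p : K}
    (hy : y * y = 0) (hxy : x * y = p • (y * x) + h) : h * y + p • (y * h) = 0 := by
  have h1 : x * y * y = 0 := by rw [mul_assoc, hy, mul_zero]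
  have h2 : y * (x * y) = y * h := by rw [hxy, mul_add, mul_smul_comm, ← mul_assoc, hy]; simp
  rw [hxy, add_mul, smul_mul_assoc, mul_assoc, h2] at h1
  rw [← h1, add_comm]

/-- Associativity of `z * x * y` when the generators commute up to scalars and correction terms. -/
theorem overlap_eq {E : Type*} [Ring E] [Algebra K E] {x y z hxy hzx hzy : E} {p a b : K}
    (h1 : x * y = p • (y * x) + hxy) (h2 : z * x = a • (x * z) + hzx)
    (h3 : z * y = b • (y * z) + hzy) :
    (p * b) • (y * hzx) + p • (hzy * x) + z * hxy =
      a • (x * hzy) + hzx * y + (a * b) • (hxy * z) := by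
  have e1 : z * (x * y) = (p * a * b) • (y * (x * z)) + (p * b) • (y * hzx) + p • (hzy * x)
      + z * hxy := by
    rw [h1, mul_add, mul_smul_comm, ← mul_assoc, h3, add_mul, smul_mul_assoc, mul_assoc, h2,
      mul_add, mul_smul_comm, mul_assoc]
    module
  have e2 : z * x * y = (p * a * b) • (y * (x * z)) + (a * b) • (hxy * z) + a • (x * hzy)
      + hzx * y := by
    rw [h2, add_mul, smul_mul_assoc, mul_assoc, h3, mul_add, mul_smul_comm, ← mul_assoc, h1,
      add_mul, smul_mul_assoc, mul_assoc y x z]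
    module
  have e := e1.symm.trans ((mul_assoc z x y).symm.trans e2)
  rw [← sub_eq_zero] at e ⊢
  rw [← e]
  abel

section Constraints

variable (μ : hochschildZ2 (incl q G))

/-- Supplies the correction terms for the overlap identities. -/
theorem inl_gen_mul_inl_gen {r s : Fin n} (h : r ≠ s) :
    HochschildExt.inl μ (gen q r) * HochschildExt.inl μ (gen q s) =
      q s r • (HochschildExt.inl μ (gen q s) * HochschildExt.inl μ (gen q r)) +
        HochschildExt.inr μ (μ.1 (eps q r s)) := by
  ext : 1
  · simp [gen_mul_gen s r h.symm]
  · simp [eps_of_ne h]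

variable {μ}

theorem inl_gen_mul_self (hμ : μ ∈ constCocycles q G) (i : Fin n) :
    HochschildExt.inl μ (gen q i) * HochschildExt.inl μ (gen q i) = 0 := by
  ext : 1
  · simp [gen_mul_self]
  · simpa using hμ.2 i

variable (hq : ∀ i j, i ≠ j → q i j * q j i = 1)
  (hd : ∀ (g : G) (i : Fin n), g • gen q i = d g i • gen q i)

include hd

include hq in
theorem eig_left_of_cochainCoeff_ne_zero (hμ : μ ∈ constCocycles q G) {g : G} {r s : Fin n}
    (h : r ≠ s) (hc : cochainCoeff q g r s μ.1 ≠ 0) : -q r s = d g r := by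
  have e := congrArg HochschildExt.fiber
    (mul_add_mul_eq_zero_of_sq_left (inl_gen_mul_self hμ r) (inl_gen_mul_inl_gen μ h))
  -- With `c` the constant term at `g`, the coefficient at `v_r g` reads `(1 + q_{sr} g_r^r) c = 0`.
  have e' := congrArg (genCoeff q g r) e
  simp [genCoeff_gen_mul, genCoeff_mul_gen hd, ← cochainCoeff_apply] at e'
  have e2 : 1 + q s r * d g r = 0 := by
    refine (mul_eq_zero.1 (?_ : (1 + q s r * d g r) * cochainCoeff q g r s μ.1 = 0)).resolve_right hc
    linear_combination e'
  linear_combination d g r * hq r s h - q r s * e2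

theorem eig_right_of_cochainCoeff_ne_zero (hμ : μ ∈ constCocycles q G) {g : G} {r s : Fin n}
    (h : r ≠ s) (hc : cochainCoeff q g r s μ.1 ≠ 0) : -q s r = d g s := by
  have e := congrArg HochschildExt.fiber
    (mul_add_mul_eq_zero_of_sq_right (inl_gen_mul_self hμ s) (inl_gen_mul_inl_gen μ h))
  have e' := congrArg (genCoeff q g s) e
  simp [genCoeff_gen_mul, genCoeff_mul_gen hd, ← cochainCoeff_apply] at e'
  have e2 : d g s + q s r = 0 := by
    refine (mul_eq_zero.1 (?_ : (d g s + q s r) * cochainCoeff q g r s μ.1 = 0)).resolve_right hc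
    linear_combination e'
  linear_combination -e2

include hq in
theorem eig_other_of_cochainCoeff_ne_zero {g : G} {r s k : Fin n}
    (h : r ≠ s) (hkr : k ≠ r) (hks : k ≠ s) (hc : cochainCoeff q g r s μ.1 ≠ 0) :
    q k r * q k s = d g k := by
  have e := congrArg HochschildExt.fiber
    (overlap_eq (inl_gen_mul_inl_gen μ h) (inl_gen_mul_inl_gen μ hkr) (inl_gen_mul_inl_gen μ hks))
  -- Of the six terms only `v_k h` and `h v_k`, with `h` the value on `ε_{[r]+[s]}`, contribute at
  -- `v_k g`; the others carry a factor `v_r` or `v_s`.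
  have e' := congrArg (genCoeff q g k) e
  simp [genCoeff_gen_mul, genCoeff_mul_gen hd, ← cochainCoeff_apply, hkr, hks] at e'
  have e2 : 1 - q r k * q s k * d g k = 0 := by
    refine (mul_eq_zero.1
      (?_ : (1 - q r k * q s k * d g k) * cochainCoeff q g r s μ.1 = 0)).resolve_right hc
    linear_combination e'
  linear_combination q k r * q k s * e2 + d g k * q k r * q r k * hq k s hks + d g k * hq k r hkr

end Constraints

/-! ### The constant cocycles of the index set -/

section Cup

variable (hq : ∀ i j, i ≠ j → q i j * q j i = 1)

/-- The cochain `a ⊗ b ↦ D_i(a) σ_i(D_j(b)) g`. -/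
noncomputable def cupCochain (g : G) (i j : Fin n) :
    QuantumExterior q ⊗[K] QuantumExterior q →ₗ[K] Skew q G :=
  (LinearMap.mulRight K (grp q g) ∘ₗ (incl q G).toLinearMap) ∘ₗ
    LinearMap.mul' K (QuantumExterior q) ∘ₗ
      TensorProduct.map (skewDerivation hq i)
        ((diag q (twist q i)).toLinearMap ∘ₗ skewDerivation hq j)

theorem cupCochain_tmul (g : G) (i j : Fin n) (a b : QuantumExterior q) :
    cupCochain hq g i j (a ⊗ₜ b) =
      incl q G (skewDerivation hq i a * diag q (twist q i) (skewDerivation hq j b)) * grp q g := by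
  simp [cupCochain]

theorem grp_mul_incl (g : G) (a : QuantumExterior q) :
    grp q g * incl q G a = incl q G (g • a) * grp q g := by
  change SkewMonoidAlgebra.single g 1 * SkewMonoidAlgebra.single 1 a =
    SkewMonoidAlgebra.single 1 (g • a) * SkewMonoidAlgebra.single g 1
  simp [SkewMonoidAlgebra.single_mul_single]

/-- After the two twisted Leibniz rules, what remains is `D_i(a) σ_i(D_j(b)) σ_i(σ_j(c)) g` against
`D_i(a) σ_i(D_j(b)) g c`; they agree since `g c = (ᵍc) g`. -/
theorem cupCochain_mem (g : G) (i j : Fin n)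
    (hg : ∀ a : QuantumExterior q, diag q (twist q i) (diag q (twist q j) a) = g • a) :
    cupCochain hq g i j ∈ hochschildZ2 (incl q G) := by
  intro a b c
  simp only [cupCochain_tmul, skewDerivation_mul, map_add, map_mul]
  rw [mul_assoc _ (grp q g), grp_mul_incl, hg]
  noncomm_ring

theorem cupCochain_gen (g : G) (i j r s : Fin n) :
    cupCochain hq g i j (gen q r ⊗ₜ gen q s) = if r = i ∧ s = j then grp q g else 0 := by
  rw [cupCochain_tmul, skewDerivation_gen, skewDerivation_gen]
  by_cases hr : r = i <;> by_cases hs : s = j <;> simp [hr, hs]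

theorem restrict_cupCochain (g : G) (i j : Fin n) (hij : i < j) :
    restrict q G (cupCochain hq g i j) = grpEpsStar q g i j hij := by
  funext ⟨⟨r, s⟩, hrs⟩
  simp only at hrs
  simp only [restrict, grpEpsStar, Pi.single_apply, Subtype.mk.injEq, Prod.mk.injEq]
  rcases hrs.eq_or_lt with rfl | hlt
  · rw [eps_self, cupCochain_gen]
  · rw [eps_of_ne hlt.ne, map_sub, map_smul, cupCochain_gen, cupCochain_gen,
      if_neg (c := s = i ∧ r = j), smul_zero, sub_zero]
    rintro ⟨rfl, rfl⟩
    exact lt_asymm hlt hij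

end Cup

/-! ### The basis of the space of constant classes -/

section Classes

variable (hq : ∀ i j, i ≠ j → q i j * q j i = 1)
  (hd : ∀ (g : G) (i : Fin n), g • gen q i = d g i • gen q i)

include hd in
-- The three conditions in `DiagIndex` are this identity evaluated at `v_i`, `v_j` and the remaining
-- `v_k`.
theorem diag_twist_diag_twist (x : DiagIndex q d) (a : QuantumExterior q) :
    diag q (twist q x.i) (diag q (twist q x.j) a) = x.g • a := by
  have h : (diag q (twist q x.i)).comp (diag q (twist q x.j)) =
      MulSemiringAction.toAlgHom K (QuantumExterior q) x.g := by
    refine algHom_ext fun k => ?_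
    have hij := x.lt.ne
    simp only [AlgHom.comp_apply, diag_gen, map_smul, smul_smul, MulSemiringAction.toAlgHom_apply,
      hd]
    congr 1
    by_cases hi : k = x.i
    · subst hi
      simp [twist, hij, ← x.eig_left]
    · by_cases hj : k = x.j
      · subst hj
        simp [twist, hij.symm, ← x.eig_right]
      · simp [twist, hi, hj, ← x.eig_other k hi hj, mul_comm]
  exact DFunLike.congr_fun h a

/-- The cocycle that restricts to `g ε_{[i]+[j]}^*`. -/
noncomputable def cupCocycle (x : DiagIndex q d) : hochschildZ2 (incl q G) :=
  ⟨cupCochain hq x.g x.i x.j, cupCochain_mem hq x.g x.i x.j (diag_twist_diag_twist hd x)⟩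

theorem restrict_cupCocycle (x : DiagIndex q d) :
    restrict q G (cupCocycle hq hd x).1 = grpEpsStar q x.g x.i x.j x.lt :=
  restrict_cupCochain hq x.g x.i x.j x.lt

theorem cupCocycle_mem (x : DiagIndex q d) : cupCocycle hq hd x ∈ constCocycles q G := by
  refine ⟨fun p => ?_, fun i => ?_⟩
  · rw [restrict_cupCocycle, grpEpsStar, Pi.single_apply]
    split_ifs
    · exact Submodule.subset_span ⟨x.g, rfl⟩
    · exact Submodule.zero_mem _
  · change cupCochain hq x.g x.i x.j _ = 0
    rw [cupCochain_gen, if_neg]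
    rintro ⟨h, h'⟩
    exact x.lt.ne (h.symm.trans h')

theorem cochainCoeff_cupCocycle [DecidableEq G] (x : DiagIndex q d) (g : G) {r s : Fin n}
    (hrs : r < s) : cochainCoeff q g r s (cupCocycle hq hd x).1 =
      if x.g = g ∧ x.i = r ∧ x.j = s then 1 else 0 := by
  have h := congrFun (restrict_cupCocycle hq hd x) ⟨(r, s), hrs.le⟩
  simp only [restrict, grpEpsStar, Pi.single_apply, Subtype.mk.injEq, Prod.mk.injEq] at h
  rw [cochainCoeff_apply, h]
  by_cases h1 : x.i = r ∧ x.j = s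
  · rw [if_pos ⟨h1.1.symm, h1.2.symm⟩, constCoeff_grp]
    simp [h1]
  · rw [if_neg (fun h2 => h1 ⟨h2.1.symm, h2.2.symm⟩), map_zero, if_neg fun h2 => h1 h2.2]

/-- The class in the space of constant classes. -/
noncomputable def cupClass (x : DiagIndex q d) : constClasses q G :=
  ⟨hochschildClass (incl q G) (cupCocycle hq hd x),
    Submodule.mem_map_of_mem (cupCocycle_mem hq hd x)⟩

theorem hochschildClass_eq_iff {A : Type*} [Ring A] [Algebra K A] {B : Type*} [Ring B] [Algebra K B]
    {φ : A →ₐ[K] B} {μ ν : hochschildZ2 φ} :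
    hochschildClass φ μ = hochschildClass φ ν ↔ μ.1 - ν.1 ∈ hochschildB2 φ := by
  rw [← Subtype.coe_injective.eq_iff]
  exact Submodule.Quotient.eq _

include hq in
theorem hochschildClass_eq_of_restrict_eq {μ ν : hochschildZ2 (incl q G)}
    (h : restrict q G μ.1 = restrict q G ν.1) :
    hochschildClass (incl q G) μ = hochschildClass (incl q G) ν := by
  rw [hochschildClass_eq_iff]
  refine mem_hochschildB2_of_restrict_eq_zero hq (μ - ν) ?_
  funext p
  exact sub_eq_zero.2 (congrFun h p)

theorem isClassOf_iff (x : DiagIndex q d) (c : HochschildH2 (incl q G)) :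
    IsClassOf q G c (grpEpsStar q x.g x.i x.j x.lt) ↔ c = cupClass hq hd x := by
  constructor
  · rintro ⟨μ, rfl, hμ⟩
    exact hochschildClass_eq_of_restrict_eq hq (hμ.trans (restrict_cupCocycle hq hd x).symm)
  · rintro rfl
    exact ⟨cupCocycle hq hd x, rfl, restrict_cupCocycle hq hd x⟩

omit [Group G] [MulSemiringAction G (QuantumExterior q)] [SMulCommClass G K (QuantumExterior q)] in
theorem DiagIndex.ext' {x y : DiagIndex q d} (hg : x.g = y.g) (hi : x.i = y.i) (hj : x.j = y.j) :
    x = y := by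
  cases x
  cases y
  cases hg
  cases hi
  cases hj
  rfl

omit [Group G] [MulSemiringAction G (QuantumExterior q)] [SMulCommClass G K (QuantumExterior q)] in
theorem finite_diagIndex [Finite G] : Finite (DiagIndex q d) :=
  Finite.of_injective (fun x : DiagIndex q d => (x.g, x.i, x.j)) fun x y h => by
    simp only [Prod.mk.injEq] at h
    exact DiagIndex.ext' h.1 h.2.1 h.2.2

/-- The functionals `cochainCoeff` at the indices are dual to the cup cocycles; as they kill
coboundaries, they give independence, and they also supply the coordinates for spanning. -/
theorem cochainCoeff_sum_cupCocycle [Fintype (DiagIndex q d)] (c : DiagIndex q d → K)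
    (y : DiagIndex q d) :
    cochainCoeff q y.g y.i y.j (∑ x, c x • cupCocycle hq hd x : hochschildZ2 (incl q G)).1 =
      c y := by
  classical
  simp only [AddSubmonoidClass.coe_finsetSum, map_sum, SetLike.val_smul, map_smul]
  rw [Finset.sum_eq_single y]
  · simp [cochainCoeff_cupCocycle hq hd _ _ y.lt]
  · intro x _ hx
    rw [cochainCoeff_cupCocycle hq hd _ _ y.lt, if_neg, smul_zero]
    rintro ⟨h1, h2, h3⟩
    exact hx (DiagIndex.ext' h1 h2 h3)
  · simp

theorem sum_cupClass [Fintype (DiagIndex q d)] (c : DiagIndex q d → K) :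
    ((∑ x, c x • cupClass hq hd x : constClasses q G) : HochschildH2 (incl q G)) =
      hochschildClass (incl q G) (∑ x, c x • cupCocycle hq hd x) := by
  simp only [map_sum, map_smul, AddSubmonoidClass.coe_finsetSum, SetLike.val_smul]
  rfl

theorem linearIndependent_cupClass [Finite G] : LinearIndependent K (cupClass hq hd) := by
  have := finite_diagIndex (q := q) (d := d)
  have := Fintype.ofFinite (DiagIndex q d)
  refine Fintype.linearIndependent_iffₛ.2 fun c c' hc y => ?_
  have h := congrArg Subtype.val hc
  rw [sum_cupClass, sum_cupClass, hochschildClass_eq_iff] at h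
  have h' := cochainCoeff_of_mem_hochschildB2 hd y.g y.lt.ne h
  rw [map_sub, cochainCoeff_sum_cupCocycle, cochainCoeff_sum_cupCocycle] at h'
  exact sub_eq_zero.1 h'

/-- A constant cocycle is determined by its coefficients over the index set. -/
theorem restrict_eq_zero_of_mem_constCocycles {ν : hochschildZ2 (incl q G)}
    (hq : ∀ i j, i ≠ j → q i j * q j i = 1)
    (hd : ∀ (g : G) (i : Fin n), g • gen q i = d g i • gen q i)
    (hν : ν ∈ constCocycles q G)
    (h : ∀ x : DiagIndex q d, cochainCoeff q x.g x.i x.j ν.1 = 0) : restrict q G ν.1 = 0 := by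
  funext ⟨⟨r, s⟩, hrs⟩
  simp only at hrs
  rcases hrs.eq_or_lt with rfl | hlt
  · exact (congrArg ν.1 (eps_self r)).trans (hν.2 r)
  · refine eq_zero_of_mem_groupPart (hν.1 ⟨(r, s), hrs⟩) fun g => ?_
    -- A nonzero constant term at `g` would make `(g, r, s)` an index, where it vanishes by `h`.
    by_contra hc
    exact hc (h
      { g := g, i := r, j := s, lt := hlt
        eig_left := eig_left_of_cochainCoeff_ne_zero hq hd hν hlt.ne hc
        eig_right := eig_right_of_cochainCoeff_ne_zero hd hν hlt.ne hc
        eig_other := fun k hkr hks =>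
          eig_other_of_cochainCoeff_ne_zero hq hd hlt.ne hkr hks hc })

theorem span_cupClass [Finite G] : ⊤ ≤ Submodule.span K (Set.range (cupClass hq hd)) := by
  have := finite_diagIndex (q := q) (d := d)
  have := Fintype.ofFinite (DiagIndex q d)
  rintro ⟨_, μ, hμ, rfl⟩ -
  -- Subtracting the combination of cup cocycles with these coordinates leaves a constant cocycle
  -- that vanishes on all `ε_{[r]+[s]}`, hence a coboundary.
  set c : DiagIndex q d → K := fun x => cochainCoeff q x.g x.i x.j μ.1
  set ν : hochschildZ2 (incl q G) := ∑ x, c x • cupCocycle hq hd x with hν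
  have hνmem : ν ∈ constCocycles q G :=
    Submodule.sum_mem _ fun x _ => Submodule.smul_mem _ _ (cupCocycle_mem hq hd x)
  have h0 : restrict q G (μ - ν).1 = 0 := by
    refine restrict_eq_zero_of_mem_constCocycles hq hd (Submodule.sub_mem _ hμ hνmem) fun x => ?_
    rw [AddSubgroupClass.coe_sub, map_sub, hν, cochainCoeff_sum_cupCocycle, sub_self]
  have h1 : (⟨hochschildClass (incl q G) μ, Submodule.mem_map_of_mem hμ⟩ : constClasses q G) =
      ∑ x, c x • cupClass hq hd x := by
    refine Subtype.ext ?_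
    rw [sum_cupClass]
    exact hochschildClass_eq_iff.2 (mem_hochschildB2_of_restrict_eq_zero hq (μ - ν) h0)
  rw [h1]
  exact Submodule.sum_mem _ fun x _ =>
    Submodule.smul_mem _ _ (Submodule.subset_span (Set.mem_range_self x))

end Classes

end QuantumExterior

theorem mainTheorem10 {K : Type*} [Field K] (hK : ringChar K ≠ 2) {n : ℕ}
    (q : Fin n → Fin n → K) (hq0 : ∀ i j, q i j ≠ 0) (hq : ∀ i j, i ≠ j → q i j * q j i = 1)
    (G : Type*) [Group G] [Finite G] (hG : ¬ ringChar K ∣ Nat.card G)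
    [MulSemiringAction G (QuantumExterior q)] [SMulCommClass G K (QuantumExterior q)]
    (d : G → Fin n → K)
    (hd : ∀ (g : G) (i : Fin n), g • QuantumExterior.gen q i = d g i • QuantumExterior.gen q i) :
    ∃ b : Module.Basis (QuantumExterior.DiagIndex q d) K (QuantumExterior.constClasses q G),
      ∀ (x : QuantumExterior.DiagIndex q d) (c : HochschildH2 (QuantumExterior.incl q G)),
        QuantumExterior.IsClassOf q G c (QuantumExterior.grpEpsStar q x.g x.i x.j x.lt) ↔
          c = (b x : HochschildH2 (QuantumExterior.incl q G)) := by
  refine ⟨Module.Basis.mk (QuantumExterior.linearIndependent_cupClass hq hd)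
    (QuantumExterior.span_cupClass hq hd), fun x c => ?_⟩
  rw [Module.Basis.mk_apply]
  exact QuantumExterior.isClassOf_iff hq hd x c
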